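/- For all positive integers $n$ and non-negative integers $k$, we have $$ \det_{0\le i,j\le n-1}\left(\sum_{l=0}^k\binom {i+j+1}{\lfloor\frac {1} {2}(i+j+2-k)\rfloor+l}\right)= \begin{cases} 2n_1+1, &\text{if }n=(k+1)n_1\text{ and }k\equiv1\pmod 4,\\ 1, &\text{if }n=(k+1)n_1\text{ and }k\equiv3\pmod 4,\\ (-1)^{n_1/2}, &\text{if }n=(k+1)n_1\text{, and }k\text{ and }n_1\text{ are even},\\ (-1)^{(k+n_1-1)/2}, &\text{if }n=(k+1)n_1,\ k\text{ is even, and }n_1\text{ is odd},\\ 2n_1+2, &\text{if }n=(k+1)n_1+1\text{ and }k\text{ is odd},\\ 2(-1)^{n_1/2}, &\text{if }n=(k+1)n_1+1\text{, and }k\text{ and }n_1\text{ are even},\\ (-1)^{(k-1)/2}(2n_1+2), &\text{if }n=(k+1)n_1+k\text{ and }k\text{ is odd},\\ 2(-1)^{(k+n_1)/2}, &\text{if }n=(k+1)n_1+k\text{, and }k\text{ and }n_1\text{ are even},\\ 0, &\text{otherwise.} \end{cases} $$ Here a binomial coefficient $\binom mb$ with $b<0$ or $b>m$ is $0$, $n_1=\lfloor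 n/(k+1)\rfloor$ denotes the quotient of the division of $n$ by $k+1$, and the first applicable case gives the value (this matters only for $k=0$ and $k=1$). In particular, for $k=1$ we obtain, for all positive integers $n$, $$ \det_{0\le i,j\le n-1}\left(\binom {i+j+2}{\lfloor\frac {1} {2}(i+j+3)\rfloor}\right)= \det_{0\le i,j\le n-1}\left(\binom {i+j+2}{\lfloor\frac {1} {2}(i+j+2)\rfloor}\right)=n+1 . $$ -/

import Mathlib

/-- The binomial coefficient with a natural upper index `m` and an arbitrary integer lower
index `b`; it is `0` for `b < 0` (and for `b > m`). -/
def intBinom (m : ℕ) (b : ℤ) : ℤ :=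
  if 0 ≤ b then (m.choose b.toNat : ℤ) else 0

/-- The `n × n` Hankel matrix whose entries are the sums of `k + 1` consecutive binomial
coefficients `∑_{l=0}^{k} binom(i+j+1, ⌊(i+j+2-k)/2⌋ + l)`, with `0 ≤ i, j ≤ n - 1`.
The division is integer division by the positive number `2`, so it is the floor, also for a
negative numerator; the subtraction is that of `ℤ`. -/
def binomSumHankel (n k : ℕ) : Matrix (Fin n) (Fin n) ℤ :=
  Matrix.of fun i j =>
    ∑ l ∈ Finset.range (k + 1),
      intBinom ((i : ℕ) + (j : ℕ) + 1)
        ((((i : ℕ) : ℤ) + ((j : ℕ) : ℤ) + 2 - (k : ℤ)) / 2 + (l : ℤ))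

/-- The case distinction for the value of the determinant, as a function of `n`, `k` and `n₁`;
the first applicable case counts. In the exponents, all subtractions and divisions
of natural numbers are exact in the cases where they are used. -/
def hankelCases (n k n₁ : ℕ) : ℤ :=
  if n = (k + 1) * n₁ ∧ k % 4 = 1 then 2 * (n₁ : ℤ) + 1
  else if n = (k + 1) * n₁ ∧ k % 4 = 3 then 1
  else if n = (k + 1) * n₁ ∧ Even k ∧ Even n₁ then (-1) ^ (n₁ / 2)
  else if n = (k + 1) * n₁ ∧ Even k ∧ Odd n₁ then (-1) ^ ((k + n₁ - 1) / 2)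
  else if n = (k + 1) * n₁ + 1 ∧ Odd k then 2 * (n₁ : ℤ) + 2
  else if n = (k + 1) * n₁ + 1 ∧ Even k ∧ Even n₁ then 2 * (-1) ^ (n₁ / 2)
  else if n = (k + 1) * n₁ + k ∧ Odd k then (-1) ^ ((k - 1) / 2) * (2 * (n₁ : ℤ) + 2)
  else if n = (k + 1) * n₁ + k ∧ Even k ∧ Even n₁ then 2 * (-1) ^ ((k + n₁) / 2)
  else 0

/-- The value of the determinant. In each of the cases with `n = (k+1) n₁`, `n = (k+1) n₁ + 1`
(with `k ≥ 1`) or `n = (k+1) n₁ + k`, the number `n₁` is the quotient of the division of `n`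
by `k + 1`; for `k = 0` every `n` is of the form `n = (k+1) n₁`. -/
def hankelValue (n k : ℕ) : ℤ :=
  hankelCases n k (n / (k + 1))

/-! Put d = k + 1 and f(z) = (z + z⁻¹)(z^k + z^(k-2) + ⋯ + z^(-k)). The (i, j) entry is the sum of
the coefficients of z⁰ and z¹ in (z + z⁻¹)^(i+j) f(z), so the matrix is a moment matrix of a linear
functional, and its determinant survives any change to another monic basis. The basis `chebHalf`
turns the entries into f_{i+j+1} + f_{i-j} (`det_binomSumHankel`). These two indices have opposite
parity and f lives on one parity, so one term always vanishes. The simultaneous reordering `zigzag`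
of rows and columns then gives a Toeplitz matrix (k odd) or a Hankel matrix (k even) in the
coefficients of (1 + w)(1 + w + ⋯ + w^(d-1)).

Up to reversal of columns, this is an n × n minor of a unitriangular Toeplitz matrix. Jacobi's
formula (`det_hankel_complement`) trades it for a minor of size r, about d/2, of the inverse matrix,
whose series is (1 - w)/((1 + w)(1 - w^d)). Apart from alternating signs, the coefficients of that
series are constant between consecutive multiples of d, so such a small minor sees a single jump
(`det_symbolCoeff_hankel`). Its determinant is elementary and vanishes unless n ≡ 0, ±1 (mod d). The
levels grow linearly for even d, which produces the factors in n₁; for odd d they alternate between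
1 and 0, and only signs and factors 2 remain. -/

/-! ### Moment matrices and the half-integer Chebyshev basis -/

open Polynomial in
/-- The Gram determinant of a linear functional does not depend on the choice of monic
polynomials. -/
theorem det_gram_monic (Φ : ℤ[X] →ₗ[ℤ] ℤ) (p : ℕ → ℤ[X]) (hp : ∀ i, (p i).Monic)
    (hd : ∀ i, (p i).natDegree = i) (n : ℕ) :
    (Matrix.of fun i j : Fin n => Φ (p i * p j)).det =
      (Matrix.of fun i j : Fin n => Φ (X ^ ((i : ℕ) + (j : ℕ)))).det := by
  set C : Matrix (Fin n) (Fin n) ℤ := Matrix.of fun i a => (p i).coeff a with hC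
  have hCdet : C.det = 1 := by
    rw [Matrix.det_of_isLowerTriangular]
    · refine Finset.prod_eq_one fun i _ => ?_
      have := (hp i).coeff_natDegree
      rw [hd] at this
      simpa [hC] using this
    · intro i j hij
      have hij : i < j := hij
      refine coeff_eq_zero_of_natDegree_lt ?_
      rw [hd]
      exact hij
  have hsum : ∀ i : Fin n, p i = ∑ a : Fin n, (p i).coeff a • (X : ℤ[X]) ^ (a : ℕ) := by
    intro i
    rw [Fin.sum_univ_eq_sum_range (fun a => (p i).coeff a • (X : ℤ[X]) ^ a) n]
    conv_lhs => rw [(p i).as_sum_range' n (by rw [hd]; exact i.2)]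
    refine Finset.sum_congr rfl fun a _ => ?_
    rw [smul_X_eq_monomial]
  have key : (Matrix.of fun i j : Fin n => Φ (p i * p j)) =
      C * (Matrix.of fun i j : Fin n => Φ (X ^ ((i : ℕ) + (j : ℕ)))) * C.transpose := by
    ext i j
    rw [Matrix.of_apply, hsum i, hsum j, Finset.sum_mul_sum, Finset.sum_comm]
    simp only [Matrix.mul_apply, map_sum, Matrix.transpose_apply, Matrix.of_apply, hC,
      Finset.sum_mul]
    refine Finset.sum_congr rfl fun a _ => Finset.sum_congr rfl fun b _ => ?_
    rw [smul_mul_smul_comm, ← pow_add, map_smul, smul_eq_mul]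
    ring
  rw [key, Matrix.det_mul, Matrix.det_mul, Matrix.det_transpose, hCdet]
  ring

/-- The sum of the two neighbouring values of a two-sided sequence: multiplication of a Laurent
series in `z` by `z + z⁻¹`. -/
def adjSum : Module.End ℤ (ℤ → ℤ) where
  toFun f m := f (m - 1) + f (m + 1)
  map_add' f g := by ext m; simp only [Pi.add_apply]; ring
  map_smul' a f := by ext m; simp only [Pi.smul_apply, smul_eq_mul, RingHom.id_apply]; ring

theorem adjSum_apply (f : ℤ → ℤ) (m : ℤ) : adjSum f m = f (m - 1) + f (m + 1) := rfl

theorem adjSum_pow_apply (f : ℤ → ℤ) (m : ℕ) (s : ℤ) :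
    (adjSum ^ m) f s = ∑ b ∈ Finset.range (m + 1), (m.choose b : ℤ) * f (s + m - 2 * b) := by
  induction m generalizing s with
  | zero => simp
  | succ m ih =>
    rw [pow_succ', Module.End.mul_apply, adjSum_apply, ih, ih]
    rw [Finset.sum_range_succ' _ (m + 1)]
    simp only [Nat.choose_succ_succ, Nat.cast_add, add_mul, Finset.sum_add_distrib]
    refine Eq.trans ?_ (add_assoc _ _ _).symm
    congr 1
    · refine Finset.sum_congr rfl fun b _ => ?_
      congr 2
      push_cast
      ring
    · rw [Finset.sum_range_succ' _ m, Finset.sum_range_succ _ m]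
      simp only [Nat.choose_succ_self, Nat.choose_zero_right]
      push_cast
      congr 1
      · rw [zero_mul, add_zero]
        refine Finset.sum_congr rfl fun b _ => ?_
        congr 2
        ring
      · congr 2
        ring

open Polynomial in
/-- The polynomials `p` with `(1 + z) p_j(z + z⁻¹) = z ^ (-j) + z ^ (j + 1)`. -/
noncomputable def chebHalf : ℕ → ℤ[X]
  | 0 => 1
  | 1 => X - 1
  | j + 2 => X * chebHalf (j + 1) - chebHalf j

theorem chebHalf_monic_natDegree (j : ℕ) :
    (chebHalf j).Monic ∧ (chebHalf j).natDegree = j := by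
  induction j using Nat.twoStepInduction with
  | zero => exact ⟨Polynomial.monic_one, Polynomial.natDegree_one⟩
  | one =>
    constructor
    · simpa [chebHalf] using Polynomial.monic_X_sub_C (1 : ℤ)
    · simpa [chebHalf] using Polynomial.natDegree_X_sub_C (1 : ℤ)
  | more j h0 h1 =>
    have hm : (Polynomial.X * chebHalf (j + 1)).Monic := Polynomial.monic_X.mul h1.1
    have hdeg : (Polynomial.X * chebHalf (j + 1)).natDegree = j + 2 := by
      rw [Polynomial.natDegree_X_mul h1.1.ne_zero, h1.2]
    have hlt : (chebHalf j).natDegree < (Polynomial.X * chebHalf (j + 1)).natDegree := by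
      rw [hdeg, h0.2]; omega
    constructor
    · exact hm.sub_of_left (Polynomial.degree_lt_degree hlt)
    · rw [chebHalf, Polynomial.natDegree_sub_eq_left_of_natDegree_lt hlt, hdeg]

/-- Both z^(-j) + z^(j+1) and (1 + z) p_j(z + z⁻¹) satisfy u_{j+2} = (z + z⁻¹) u_{j+1} - u_j with
the same initial values; here the identity is read off coefficientwise after multiplication by f. -/
theorem aeval_chebHalf_add (f : ℤ → ℤ) (j : ℕ) (m : ℤ) :
    Polynomial.aeval adjSum (chebHalf j) f m + Polynomial.aeval adjSum (chebHalf j) f (m + 1) =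
      f (m + j + 1) + f (m - j) := by
  induction j using Nat.twoStepInduction generalizing m with
  | zero => simp [chebHalf, add_comm]
  | one =>
    simp only [chebHalf, map_sub, Polynomial.aeval_X, map_one, LinearMap.sub_apply,
      Module.End.one_apply, Pi.sub_apply, adjSum_apply, Nat.cast_one]
    rw [show m + 1 - 1 = m by ring]
    ring
  | more j h0 h1 =>
    simp only [chebHalf, map_sub, map_mul, Polynomial.aeval_X, LinearMap.sub_apply,
      Module.End.mul_apply, Pi.sub_apply, adjSum_apply]
    have e0 := h0 m
    have e1 := h1 (m - 1)
    have e2 := h1 (m + 1)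
    rw [show m - 1 + 1 = m by ring] at e1
    rw [show m + 1 - 1 = m by ring]
    push_cast at *
    rw [show m - 1 + (j + 1) + 1 = m + j + 1 by ring,
      show m - 1 - ((j : ℤ) + 1) = m - (j + 2) by ring] at e1
    rw [show m + 1 + ((j : ℤ) + 1) + 1 = m + (j + 2) + 1 by ring,
      show m + 1 - ((j : ℤ) + 1) = m - j by ring] at e2
    linarith

/-- The element z + z⁻¹ is invariant under z ↦ z⁻¹. -/
theorem aeval_adjSum_neg (f : ℤ → ℤ) (hf : ∀ s, f (-s) = f s) (p : Polynomial ℤ) (s : ℤ) :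
    Polynomial.aeval adjSum p f (-s) = Polynomial.aeval adjSum p f s := by
  have hX : ∀ (m : ℕ) (s : ℤ), (adjSum ^ m) f (-s) = (adjSum ^ m) f s := by
    intro m
    induction m with
    | zero => simpa using hf
    | succ m ih =>
      intro s
      rw [pow_succ', Module.End.mul_apply, adjSum_apply, adjSum_apply,
        show -s - 1 = -(s + 1) by ring, show -s + 1 = -(s - 1) by ring, ih, ih, add_comm]
  rw [Polynomial.aeval_eq_sum_range]
  simp only [LinearMap.sum_apply, LinearMap.smul_apply, Finset.sum_apply, Pi.smul_apply, hX]

/-- The Hankel determinant of the coefficient sums `[z⁰] + [z¹]` of `(z + z⁻¹) ^ m f(z)` is a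
Toeplitz-plus-Hankel determinant in the coefficients of `f`. -/
theorem det_hankel_adjSum (f : ℤ → ℤ) (hf : ∀ s, f (-s) = f s) (n : ℕ) :
    (Matrix.of fun i j : Fin n =>
      (adjSum ^ ((i : ℕ) + (j : ℕ))) f 0 + (adjSum ^ ((i : ℕ) + (j : ℕ))) f 1).det =
    (Matrix.of fun i j : Fin n =>
      f (((i : ℕ) : ℤ) + ((j : ℕ) : ℤ) + 1) + f (((i : ℕ) : ℤ) - ((j : ℕ) : ℤ))).det := by
  let ev : (ℤ → ℤ) →ₗ[ℤ] ℤ :=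
    LinearMap.proj (R := ℤ) (φ := fun _ : ℤ => ℤ) 0 + LinearMap.proj (R := ℤ) (φ := fun _ : ℤ => ℤ) 1
  let Φ : Polynomial ℤ →ₗ[ℤ] ℤ :=
    ev ∘ₗ (LinearMap.applyₗ f) ∘ₗ (Polynomial.aeval (R := ℤ) adjSum).toLinearMap
  have hΦ : ∀ p, Φ p = Polynomial.aeval adjSum p f 0 + Polynomial.aeval adjSum p f 1 :=
    fun p => rfl
  have := det_gram_monic Φ chebHalf (fun i => (chebHalf_monic_natDegree i).1)
    (fun i => (chebHalf_monic_natDegree i).2) n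
  simp only [hΦ, map_pow, Polynomial.aeval_X] at this
  rw [← this]
  congr 1
  ext i j
  simp only [Matrix.of_apply]
  -- Applied to p_j f at 0, the identity gives the values at i + 1 and -i. Evenness replaces -i by
  -- i, and these two neighbours allow a second application, now to f at i.
  have h := aeval_chebHalf_add (Polynomial.aeval adjSum (chebHalf j) f) i 0
  rw [← Module.End.mul_apply, ← map_mul, zero_add, zero_add, zero_sub,
    aeval_adjSum_neg f hf, add_comm (Polynomial.aeval adjSum (chebHalf j) f _),
    aeval_chebHalf_add] at h
  exact h

/-! ### Binomial sums as Laurent coefficients -/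

/-- The coefficients of `z ^ k + z ^ (k - 2) + ⋯ + z ^ (-k)`. -/
def parityWindow (k : ℕ) (s : ℤ) : ℤ :=
  if -(k : ℤ) ≤ s ∧ s ≤ k ∧ (s - k) % 2 = 0 then 1 else 0

theorem parityWindow_neg (k : ℕ) (s : ℤ) : parityWindow k (-s) = parityWindow k s := by
  unfold parityWindow
  congr 1
  apply propext
  omega

theorem sum_intBinom (m k : ℕ) (e : ℤ) :
    ∑ l ∈ Finset.range (k + 1), intBinom m (e + l) =
      ∑ b ∈ Finset.range (m + 1), (m.choose b : ℤ) * if e ≤ b ∧ (b : ℤ) ≤ e + k then 1 else 0 := by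
  have h : ∀ l : ℕ, intBinom m (e + l) =
      ∑ b ∈ Finset.range (m + 1), if (b : ℤ) = e + l then (m.choose b : ℤ) else 0 := by
    intro l
    unfold intBinom
    split_ifs with h0
    · obtain ⟨c, hc⟩ := Int.eq_ofNat_of_zero_le h0
      simp only [hc, Int.toNat_natCast, Nat.cast_inj, Finset.sum_ite_eq', Finset.mem_range]
      split_ifs with h1
      · rfl
      · rw [Nat.choose_eq_zero_of_lt (by omega)]; rfl
    · symm
      refine Finset.sum_eq_zero fun b _ => if_neg (by omega)
  simp only [h]
  rw [Finset.sum_comm]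
  refine Finset.sum_congr rfl fun b _ => ?_
  split_ifs with hb
  · obtain ⟨c, hc⟩ := Int.eq_ofNat_of_zero_le (show 0 ≤ (b : ℤ) - e by omega)
    rw [Finset.sum_eq_single c]
    · rw [if_pos (by omega), mul_one]
    · intro l _ hl
      exact if_neg (by omega)
    · intro hcm
      rw [Finset.mem_range] at hcm
      omega
  · rw [mul_zero]
    refine Finset.sum_eq_zero fun l hl => if_neg ?_
    rw [Finset.mem_range] at hl
    omega

/-- By parity only one of the evaluation points 0 and 1 meets the window, the same one for every b.
The b that fall inside are k + 1 consecutive integers; the floor in their starting point absorbs the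
choice between 0 and 1. -/
theorem adjSum_pow_parityWindow (m k : ℕ) :
    (adjSum ^ m) (adjSum (parityWindow k)) 0 + (adjSum ^ m) (adjSum (parityWindow k)) 1 =
      ∑ l ∈ Finset.range (k + 1), intBinom (m + 1) (((m : ℤ) + 2 - k) / 2 + l) := by
  rw [← Module.End.mul_apply, ← pow_succ, adjSum_pow_apply, adjSum_pow_apply, sum_intBinom,
    ← Finset.sum_add_distrib]
  refine Finset.sum_congr rfl fun b _ => ?_
  rw [← mul_add]
  congr 1
  unfold parityWindow
  push_cast
  split_ifs <;> first | rfl | omega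

theorem det_binomSumHankel (n k : ℕ) :
    (binomSumHankel n k).det = (Matrix.of fun i j : Fin n =>
      adjSum (parityWindow k) (((i : ℕ) : ℤ) + ((j : ℕ) : ℤ) + 1) +
        adjSum (parityWindow k) (((i : ℕ) : ℤ) - ((j : ℕ) : ℤ))).det := by
  rw [← det_hankel_adjSum]
  · congr 1
    ext i j
    simp only [binomSumHankel, Matrix.of_apply]
    rw [adjSum_pow_parityWindow]
    push_cast
    rfl
  · intro s
    rw [adjSum_apply, adjSum_apply, show -s - 1 = -(s + 1) by ring,
      show -s + 1 = -(s - 1) by ring, parityWindow_neg, parityWindow_neg, add_comm]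

/-! ### Reversal of columns: Hankel versus Toeplitz -/

/-- The determinant of the `n × n` exchange matrix. -/
def revSign : ℕ → ℤ
  | 0 => 1
  | n + 1 => (-1) ^ n * revSign n

theorem revSign_mul_self (n : ℕ) : revSign n * revSign n = 1 := by
  induction n with
  | zero => rfl
  | succ n ih =>
    rw [revSign, mul_mul_mul_comm, ih, ← pow_add, ← two_mul, pow_mul]
    norm_num

theorem revSign_add (m n : ℕ) :
    revSign (m + n) = (-1) ^ (m * n) * (revSign m * revSign n) := by
  induction n with
  | zero => simp [revSign]
  | succ n ih =>
    rw [← add_assoc, revSign, revSign, ih, mul_add, mul_one, pow_add, pow_add]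
    ring

theorem revSign_even_odd (m : ℕ) :
    revSign (2 * m) = (-1) ^ m ∧ revSign (2 * m + 1) = (-1) ^ m := by
  induction m with
  | zero => simp [revSign]
  | succ m ih =>
    have h : revSign (2 * (m + 1)) = (-1) ^ (m + 1) := by
      rw [show 2 * (m + 1) = 2 * m + 1 + 1 by ring, revSign, ih.2, pow_succ, pow_mul]
      norm_num
      ring
    refine ⟨h, ?_⟩
    rw [revSign, h, pow_mul]
    norm_num

theorem det_exchange (n : ℕ) :
    (Matrix.of fun i j : Fin n => if (i : ℕ) + j + 1 = n then (1 : ℤ) else 0).det = revSign n := by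
  induction n with
  | zero => simp [revSign]
  | succ n ih =>
    rw [Matrix.det_succ_row_zero, Finset.sum_eq_single (Fin.last n)]
    · rw [revSign, ← ih]
      congr 1
      · simp
      · congr 1
        ext i j
        simp only [Matrix.submatrix_apply, Matrix.of_apply, Fin.succAbove_last, Fin.val_succ,
          Fin.val_castSucc]
        congr 1
        apply propext
        omega
    · intro j _ hj
      have : (j : ℕ) ≠ n := fun h => hj (Fin.ext h)
      simp [this]
    · simp

theorem det_reverse_columns {n : ℕ} (M : Matrix (Fin n) (Fin n) ℤ) :
    (Matrix.of fun i j => M i (Fin.rev j)).det = revSign n * M.det := by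
  rw [← det_exchange, mul_comm, ← Matrix.det_mul]
  congr 1
  ext i j
  rw [Matrix.mul_apply, Finset.sum_eq_single (Fin.rev j)]
  · have : ((Fin.rev j : Fin n) : ℕ) + j + 1 = n := by rw [Fin.val_rev]; omega
    rw [Matrix.of_apply, Matrix.of_apply, if_pos this, mul_one]
  · intro x _ hx
    have : (x : ℕ) + j + 1 ≠ n := fun h => hx (Fin.ext (by rw [Fin.val_rev]; omega))
    rw [Matrix.of_apply, if_neg this, mul_zero]
  · simp

theorem det_hankel_eq_toeplitz (f : ℤ → ℤ) (n : ℕ) :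
    (Matrix.of fun i j : Fin n => f (((i : ℕ) : ℤ) + ((j : ℕ) : ℤ) + 1 - n)).det =
      revSign n * (Matrix.of fun i j : Fin n => f (((i : ℕ) : ℤ) - ((j : ℕ) : ℤ))).det := by
  rw [← det_reverse_columns]
  congr 1
  ext i j
  simp only [Matrix.of_apply]
  congr 1
  rw [Fin.val_rev]
  omega

/-! ### Complementary minors -/

section Complement

variable (p h : ℤ → ℤ)

/-- Lower triangular Toeplitz matrices multiply by convolution. Truncation at N is harmless, because
only j ≤ m ≤ i contributes. -/
theorem sum_convolution_window (hp : ∀ m < 0, p m = 0) (hh : ∀ m < 0, h m = 0)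
    (hconv : ∀ m : ℕ, ∑ u ∈ Finset.range (m + 1), p ((m : ℤ) - u) * h u = if m = 0 then 1 else 0)
    (N i j : ℕ) (hi : i < N) :
    ∑ m ∈ Finset.range N, p ((i : ℤ) - m) * h ((m : ℤ) - j) = if i = j then 1 else 0 := by
  rcases lt_or_ge i j with hij | hij
  · rw [if_neg hij.ne]
    refine Finset.sum_eq_zero fun m _ => ?_
    rcases lt_or_ge i m with him | him
    · rw [hp _ (by omega), zero_mul]
    · rw [hh _ (by omega), mul_zero]
  · obtain ⟨t, rfl⟩ := Nat.exists_eq_add_of_le hij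
    have hsub : Finset.range (j + (t + 1)) ⊆ Finset.range N := by
      intro x hx
      rw [Finset.mem_range] at hx ⊢
      omega
    rw [← Finset.sum_subset hsub, Finset.sum_range_add, Finset.sum_eq_zero, zero_add]
    · have hjt : (if j + t = j then (1 : ℤ) else 0) = if t = 0 then 1 else 0 := by simp
      rw [hjt, ← hconv t]
      refine Finset.sum_congr rfl fun u _ => ?_
      congr 2 <;> push_cast <;> ring
    · intro x hx
      rw [Finset.mem_range] at hx
      rw [hh _ (by omega), mul_zero]
    · intro x _ hx
      rw [Finset.mem_range] at hx
      rw [hp _ (by push_cast; omega), zero_mul]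

/-- Jacobi's complementary minor formula for a pair of mutually inverse unitriangular Toeplitz
matrices, in Hankel form. -/
theorem det_hankel_complement (hp : ∀ m < 0, p m = 0) (hh : ∀ m < 0, h m = 0) (hp0 : p 0 = 1)
    (hconv : ∀ m : ℕ, ∑ u ∈ Finset.range (m + 1), p ((m : ℤ) - u) * h u = if m = 0 then 1 else 0)
    (n r : ℕ) :
    (Matrix.of fun i j : Fin n => p (((i : ℕ) : ℤ) + ((j : ℕ) : ℤ) + r + 1 - n)).det =
      revSign (r + n) * (Matrix.of fun i j : Fin r =>
        h ((n : ℤ) + r - 1 - ((i : ℕ) : ℤ) - ((j : ℕ) : ℤ))).det := by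
  let v : Fin r ⊕ Fin n → ℕ := fun x => (finSumFinEquiv x : Fin (r + n))
  have hvl : ∀ i : Fin r, v (Sum.inl i) = i := fun i => by simp [v]
  have hvr : ∀ i : Fin n, v (Sum.inr i) = r + i := fun i => by simp [v]
  let A : Matrix (Fin r ⊕ Fin n) (Fin r ⊕ Fin n) ℤ :=
    Matrix.of fun x y => p ((v x : ℤ) + (v y : ℤ) + 1 - (r + n : ℕ))
  let B : Matrix (Fin r ⊕ Fin n) (Fin r) ℤ :=
    Matrix.of fun x j => h ((n : ℤ) + r - 1 - (v x : ℤ) - ((j : ℕ) : ℤ))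
  have hA : A.det = revSign (r + n) := by
    have : A = (Matrix.of fun i j : Fin (r + n) =>
        p (((i : ℕ) : ℤ) + ((j : ℕ) : ℤ) + 1 - (r + n : ℕ))).submatrix
          finSumFinEquiv finSumFinEquiv := rfl
    rw [this, Matrix.det_submatrix_equiv_self, det_hankel_eq_toeplitz,
      Matrix.det_of_isLowerTriangular]
    · simp [hp0]
    · intro i j hij
      have hij : i < j := hij
      exact hp _ (by simp only [Fin.lt_def] at hij; omega)
  have hAB : ∀ x (j : Fin r), (A * B) x j = if v x = j then 1 else 0 := by
    intro x j
    have hx : v x < r + n := Fin.is_lt _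
    rw [Matrix.mul_apply, ← sum_convolution_window p h hp hh hconv (r + n) (v x) j hx,
      ← Finset.sum_range_reflect, ← Fin.sum_univ_eq_sum_range
        (fun m => p ((v x : ℤ) - ((r + n - 1 - m : ℕ) : ℤ)) * h (((r + n - 1 - m : ℕ) : ℤ) - (j : ℕ)))]
    refine Fintype.sum_equiv finSumFinEquiv _ _ fun y => ?_
    have hy : v y < r + n := Fin.is_lt _
    change p ((v x : ℤ) + (v y : ℤ) + 1 - (r + n : ℕ)) *
      h ((n : ℤ) + r - 1 - (v y : ℤ) - ((j : ℕ) : ℤ)) =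
      p ((v x : ℤ) - ((r + n - 1 - v y : ℕ) : ℤ)) * h (((r + n - 1 - v y : ℕ) : ℤ) - (j : ℕ))
    congr 2 <;> omega
  -- `B` consists of the first r columns of the inverse of `A`. Completed by unit columns, it makes
  -- `A * C` block triangular with the wanted minor in the lower right corner, while the determinant
  -- of `C` is that of the top block of `B`.
  let C : Matrix (Fin r ⊕ Fin n) (Fin r ⊕ Fin n) ℤ :=
    Matrix.fromBlocks (B.submatrix Sum.inl id) 0 (B.submatrix Sum.inr id) 1
  have hblock : A * C =
      Matrix.fromBlocks 1 (A.submatrix Sum.inl Sum.inr) 0 (A.submatrix Sum.inr Sum.inr) := by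
    have hl : ∀ x j, (A * C) x (Sum.inl j) = (A * B) x j := by
      intro x j
      simp [C, Matrix.mul_apply, Fintype.sum_sum_type]
    have hr : ∀ x j, (A * C) x (Sum.inr j) = A x (Sum.inr j) := by
      intro x j
      simp [C, Matrix.mul_apply, Fintype.sum_sum_type, Matrix.one_apply]
    ext x y
    rcases y with j | j
    · rw [hl, hAB]
      rcases x with i | i
      · simp [hvl, Matrix.one_apply, Fin.ext_iff]
      · have : r + (i : ℕ) ≠ j := by omega
        simp [hvr, this]
    · rw [hr]
      rcases x with i | i <;> rfl
  have hdet := congrArg Matrix.det hblock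
  rw [Matrix.det_mul, Matrix.det_fromBlocks_zero₁₂, Matrix.det_fromBlocks_zero₂₁, Matrix.det_one,
    Matrix.det_one, one_mul, mul_one, hA] at hdet
  convert hdet.symm using 2
  · ext i j
    simp only [Matrix.of_apply, Matrix.submatrix_apply, A, hvr]
    congr 1
    push_cast
    ring
  · congr 1

end Complement

/-! ### Toeplitz determinants of a step -/

/-- A sequence with two values, left and right of `0`, and their mean at `0`. -/
def stepSeq (a c s : ℤ) : ℤ := if s < 0 then 2 * a else if s = 0 then a + c else 2 * c

theorem stepSeq_neg (a c s : ℤ) : stepSeq a c (-s) = stepSeq c a s := by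
  unfold stepSeq
  split_ifs <;> first | rfl | omega

/-- Subtracting from each column its predecessor leaves a lower triangular matrix with diagonal 2a,
a - c, …, a - c. -/
theorem det_step_sub_one (a c : ℤ) (r : ℕ) :
    (Matrix.of fun i j : Fin (r + 1) =>
      stepSeq a c (-1 + (((i : ℕ) : ℤ) - ((j : ℕ) : ℤ)))).det = (a - c) ^ r * (2 * a) := by
  let N : Matrix (Fin (r + 1)) (Fin (r + 1)) ℤ := Matrix.of fun i j =>
    if (j : ℕ) = 0 then stepSeq a c (-1 + ((i : ℕ) : ℤ))
    else if (i : ℕ) = j then a - c else if (i : ℕ) = j + 1 then a - c else 0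
  rw [Matrix.det_eq_of_forall_col_eq_smul_add_pred (B := N) (fun _ => 1),
    Matrix.det_of_isLowerTriangular, Fin.prod_univ_succ]
  · simp [N, stepSeq, mul_comm]
  · intro i j hij
    have hij : i < j := hij
    rw [Fin.lt_def] at hij
    simp only [N, Matrix.of_apply]
    rw [if_neg (by omega), if_neg (by omega), if_neg (by omega)]
  · intro i
    simp [N]
  · intro i j
    simp only [N, Matrix.of_apply, Fin.val_succ, Fin.val_castSucc, stepSeq]
    push_cast
    split_ifs <;> omega

/-- Column differences leave a - c on the diagonal and superdiagonal, outside the first column.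
Alternating row sums then clear that diagonal, so the last row retains only its first entry, a + c
or c - a by parity. -/
theorem det_step_zero {a c : ℤ} (hac : (c - a) * (c - a) = 1) (r : ℕ) :
    (Matrix.of fun i j : Fin r => stepSeq a c (0 + (((i : ℕ) : ℤ) - ((j : ℕ) : ℤ)))).det =
      if Even r then 1 else a + c := by
  rcases r with - | r
  · simp
  let N : Matrix (Fin (r + 1)) (Fin (r + 1)) ℤ := Matrix.of fun i j =>
    if (j : ℕ) = 0 then stepSeq a c ((i : ℕ) : ℤ)
    else if (i : ℕ) = j then a - c else if (i : ℕ) + 1 = j then a - c else 0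
  let A : Matrix (Fin (r + 1)) (Fin (r + 1)) ℤ := Matrix.of fun i j =>
    if (j : ℕ) = 0 then (if (i : ℕ) % 2 = 0 then a + c else c - a)
    else if (i : ℕ) + 1 = j then a - c else 0
  have hFN : (Matrix.of fun i j : Fin (r + 1) =>
      stepSeq a c (0 + (((i : ℕ) : ℤ) - ((j : ℕ) : ℤ)))).det = N.det := by
    refine Matrix.det_eq_of_forall_col_eq_smul_add_pred (fun _ => 1) ?_ ?_
    · intro i
      simp [N]
    · intro i j
      simp only [N, Matrix.of_apply, Fin.val_succ, Fin.val_castSucc, stepSeq]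
      push_cast
      split_ifs <;> omega
  have hAN : A.det = N.det := by
    refine Matrix.det_eq_of_forall_row_eq_smul_add_pred (fun _ => -1) ?_ ?_
    · intro j
      simp only [N, A, Matrix.of_apply, Fin.val_zero, stepSeq]
      split_ifs <;> omega
    · intro i j
      simp only [N, A, Matrix.of_apply, Fin.val_succ, Fin.val_castSucc, stepSeq]
      push_cast
      split_ifs <;> omega
  rw [hFN, ← hAN, Matrix.det_succ_row A (Fin.last r), Finset.sum_eq_single 0]
  · have hsub : A.submatrix (Fin.last r).succAbove (Fin.succAbove 0) =
        Matrix.diagonal fun _ => a - c := by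
      ext i j
      simp only [A, Matrix.submatrix_apply, Matrix.of_apply, Fin.succAbove_last,
        Fin.succAbove_zero, Fin.val_castSucc, Fin.val_succ, Matrix.diagonal_apply, Fin.ext_iff]
      rw [if_neg (by omega)]
      simp only [Nat.add_right_cancel_iff]
    have hA0 : A (Fin.last r) 0 = if r % 2 = 0 then a + c else c - a := by simp [A]
    rw [hsub, Matrix.det_diagonal, hA0]
    simp only [Finset.prod_const, Finset.card_univ, Fintype.card_fin, Fin.val_last, Fin.val_zero,
      add_zero]
    have hsq : ∀ m : ℕ, (c - a) ^ (2 * m) = 1 := fun m => by rw [pow_mul, sq, hac, one_pow]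
    rw [mul_right_comm, ← mul_pow, show -1 * (a - c) = c - a by ring]
    rcases Nat.even_or_odd' r with ⟨m, rfl | rfl⟩
    · rw [hsq, if_pos (by omega), if_neg (by simp [parity_simps]), one_mul]
    · rw [pow_succ, hsq, if_neg (by omega), if_pos (by simp [parity_simps]), one_mul, hac]
  · intro j _ hj
    have hj0 : (j : ℕ) ≠ 0 := fun h => hj (Fin.ext h)
    have : A (Fin.last r) j = 0 := by
      simp only [A, Matrix.of_apply, Fin.val_last]
      rw [if_neg hj0, if_neg (by omega)]
    rw [this]
    ring
  · simp

theorem det_step_transpose (a c δ : ℤ) (r : ℕ) :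
    (Matrix.of fun i j : Fin r => stepSeq a c (δ + (((i : ℕ) : ℤ) - ((j : ℕ) : ℤ)))).det =
      (Matrix.of fun i j : Fin r =>
        stepSeq c a (-δ + (((i : ℕ) : ℤ) - ((j : ℕ) : ℤ)))).det := by
  rw [← Matrix.det_transpose]
  congr 1
  ext i j
  simp only [Matrix.transpose_apply, Matrix.of_apply]
  rw [← stepSeq_neg]
  congr 1
  ring

theorem det_step_add_one (a c : ℤ) (r : ℕ) :
    (Matrix.of fun i j : Fin (r + 1) =>
      stepSeq a c (1 + (((i : ℕ) : ℤ) - ((j : ℕ) : ℤ)))).det = (c - a) ^ r * (2 * c) := by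
  rw [det_step_transpose, det_step_sub_one]

/-- The last two rows lie entirely to the right of the jump, hence coincide. -/
theorem det_step_of_two_le (a c δ : ℤ) (r : ℕ) (hδ : 2 ≤ δ) (hr : 2 ≤ r) :
    (Matrix.of fun i j : Fin r =>
      stepSeq a c (δ + (((i : ℕ) : ℤ) - ((j : ℕ) : ℤ)))).det = 0 := by
  refine Matrix.det_zero_of_row_eq (i := ⟨r - 2, by omega⟩) (j := ⟨r - 1, by omega⟩) ?_ ?_
  · simp only [ne_eq, Fin.mk.injEq]
    omega
  · ext j
    simp only [Matrix.of_apply, stepSeq]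
    split_ifs <;> first | rfl | omega

theorem det_step_of_le_neg_two (a c δ : ℤ) (r : ℕ) (hδ : δ ≤ -2) (hr : 2 ≤ r) :
    (Matrix.of fun i j : Fin r =>
      stepSeq a c (δ + (((i : ℕ) : ℤ) - ((j : ℕ) : ℤ)))).det = 0 := by
  rw [det_step_transpose, det_step_of_two_le _ _ _ _ (by omega) hr]

/-! ### The symbol and its reciprocal series -/

section Sequences

variable (d : ℕ)

/-- The coefficients of `1 + w + ⋯ + w ^ (d - 1)`. -/
def geomCoeff (m : ℤ) : ℤ := if 0 ≤ m ∧ m < d then 1 else 0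

/-- The coefficients of `(1 + w) (1 + w + ⋯ + w ^ (d - 1))`. -/
def symbolCoeff (m : ℤ) : ℤ := geomCoeff d m + geomCoeff d (m - 1)

/-- The sum of `(-1) ^ (d q)` over `0 ≤ q ≤ M`. -/
def signCount (M : ℤ) : ℤ :=
  if M < 0 then 0 else if Even d then M + 1 else if Even M then 1 else 0

/-- The coefficients of `1 / ((1 + w) (1 - w ^ d))`. -/
def cycloInvCoeff (m : ℤ) : ℤ := (m.negOnePow : ℤ) * signCount d (m / d)

/-- The coefficients of the inverse of the series with coefficients `symbolCoeff d`. -/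
def symbolInvCoeff (m : ℤ) : ℤ := cycloInvCoeff d m - cycloInvCoeff d (m - 1)

theorem signCount_of_neg (M : ℤ) (hM : M < 0) : signCount d M = 0 := if_pos hM

theorem signCount_sub (M : ℤ) (hM : 0 ≤ M) :
    signCount d M - signCount d (M - 1) = ((d * M).negOnePow : ℤ) := by
  unfold signCount
  rcases Nat.even_or_odd d with hd | hd
  · rw [Int.negOnePow_even _ (((Int.even_coe_nat d).2 hd).mul_right M)]
    simp only [hd, if_true, Units.val_one]
    split_ifs <;> omega
  · have hd' : ¬ Even d := Nat.not_even_iff_odd.2 hd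
    have hdz : Odd (d : ℤ) := (Int.odd_coe_nat d).2 hd
    rcases Int.even_or_odd M with hM2 | hM2
    · rw [Int.negOnePow_even _ (hM2.mul_left _)]
      have : ¬ Even (M - 1) := by simpa [parity_simps] using hM2
      simp only [hd', hM2, this, if_true, if_false, Units.val_one, ite_self, sub_zero]
      rw [if_neg (by omega)]
    · rw [Int.negOnePow_odd _ (hdz.mul hM2)]
      have h1 : Even (M - 1) := by simpa [parity_simps] using hM2
      have h2 : ¬ Even M := Int.not_even_iff_odd.2 hM2
      have h3 : M ≠ 0 := by rintro rfl; simp at h2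
      simp only [hd', h1, h2, if_true, if_false, Units.val_neg, Units.val_one]
      rw [if_neg (by omega), if_neg (by omega)]
      norm_num

variable {d}

theorem cycloInvCoeff_of_neg (hd : 0 < d) (m : ℤ) (hm : m < 0) : cycloInvCoeff d m = 0 := by
  rw [cycloInvCoeff, signCount_of_neg _ _ (Int.ediv_neg_of_neg_of_pos hm (by omega)), mul_zero]

theorem negOnePow_sub_one (m : ℤ) : ((m - 1).negOnePow : ℤ) = -(m.negOnePow : ℤ) := by
  rw [Int.negOnePow_sub, Int.negOnePow_one]
  simp

theorem symbolInvCoeff_eq (m : ℤ) : symbolInvCoeff d m =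
    (m.negOnePow : ℤ) * (signCount d ((m - 1) / d) + signCount d (m / d)) := by
  rw [symbolInvCoeff, cycloInvCoeff, cycloInvCoeff, negOnePow_sub_one]
  ring

/-- Up to sign, the coefficient at m adds the levels at m - 1 and m. These agree unless d divides m,
which explains the values 2a, a + c, 2c of `stepSeq`. -/
theorem symbolInvCoeff_add (hd : 0 < d) (M s : ℤ) (hs : |s| < d) :
    symbolInvCoeff d (d * M + s) = ((d * M + s).negOnePow : ℤ) *
      stepSeq (signCount d (M - 1)) (signCount d M) s := by
  have hdz : (0 : ℤ) < d := by exact_mod_cast hd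
  rw [abs_lt] at hs
  have hdiv : ∀ t : ℤ, (d * M + t) / d = M + t / d := fun t => by
    rw [add_comm, Int.add_mul_ediv_left _ _ hdz.ne', add_comm]
  have hneg : ∀ t : ℤ, t < 0 → -d ≤ t → t / d = -1 := fun t h0 h1 => by
    rw [Int.ediv_eq_iff_of_pos hdz]
    constructor <;> linarith
  have hpos : ∀ t : ℤ, 0 ≤ t → t < d → t / d = 0 := fun t h0 h1 => Int.ediv_eq_zero_of_lt h0 h1
  rw [symbolInvCoeff_eq, add_sub_assoc, hdiv, hdiv, stepSeq]
  congr 1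
  split_ifs with h1 h2
  · rw [hneg _ h1 (by omega), hneg (s - 1) (by omega) (by omega), ← sub_eq_add_neg, two_mul]
  · rw [hpos s (by omega) (by omega), hneg (s - 1) (by omega) (by omega), ← sub_eq_add_neg,
      add_zero]
  · rw [hpos s (by omega) (by omega), hpos (s - 1) (by omega) (by omega), add_zero, two_mul]

/-- Multiplication by 1 + w must leave 1/(1 - w^d): only at a multiple of d does `signCount` gain a
term, and its sign cancels the alternating one. -/
theorem cycloInvCoeff_add (hd : 0 < d) (m : ℤ) : cycloInvCoeff d m + cycloInvCoeff d (m - 1) =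
    if 0 ≤ m ∧ (d : ℤ) ∣ m then 1 else 0 := by
  have hdz : (0 : ℤ) < d := by exact_mod_cast hd
  rcases lt_or_ge m 0 with hm | hm
  · rw [cycloInvCoeff_of_neg hd _ hm, cycloInvCoeff_of_neg hd _ (by omega), if_neg (by omega)]
    rfl
  · rw [cycloInvCoeff, cycloInvCoeff, negOnePow_sub_one]
    have hdm := Int.emod_add_mul_ediv m d
    have h0 := Int.emod_nonneg m hdz.ne'
    have h1 := Int.emod_lt_of_pos m hdz
    split_ifs with h
    · obtain ⟨M, rfl⟩ := h.2
      have hM : 0 ≤ M := nonneg_of_mul_nonneg_right hm hdz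
      have e1 : (d : ℤ) * M / d = M := Int.mul_ediv_cancel_left _ hdz.ne'
      have e2 : ((d : ℤ) * M - 1) / d = M - 1 := by
        rw [Int.ediv_eq_iff_of_pos hdz]
        constructor <;> linarith
      have := signCount_sub d M hM
      rw [e1, e2, neg_mul, ← sub_eq_add_neg, ← mul_sub, this, ← Units.val_mul,
        Int.units_mul_self, Units.val_one]
    · have hne : m % d ≠ 0 := fun h' => h ⟨hm, Int.dvd_of_emod_eq_zero h'⟩
      have : (m - 1) / d = m / d := by
        rw [Int.ediv_eq_iff_of_pos hdz]
        have : 1 ≤ m % d := by omega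
        constructor <;> linarith
      rw [this]
      ring

open PowerSeries in
theorem mk_sub_shift (f : ℤ → ℤ) (hf : ∀ m < 0, f m = 0) (e : ℕ) :
    (mk fun m : ℕ => f m) * (1 - X ^ e) = mk fun m : ℕ => f m - f (m - e) := by
  ext m
  rw [mul_sub, mul_one, map_sub, coeff_mul_X_pow', coeff_mk]
  split_ifs with h
  · rw [coeff_mk, coeff_mk, Nat.cast_sub h]
  · rw [coeff_mk, hf (m - e) (by omega)]

open PowerSeries in
theorem mk_add_shift (f : ℤ → ℤ) (hf : ∀ m < 0, f m = 0) :
    (mk fun m : ℕ => f m) * (1 + X) = mk fun m : ℕ => f m + f (m - 1) := by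
  ext m
  rw [mul_add, mul_one, map_add, ← pow_one (X : ℤ⟦X⟧), coeff_mul_X_pow', coeff_mk]
  split_ifs with h
  · rw [coeff_mk, coeff_mk, Nat.cast_sub h, Nat.cast_one]
  · rw [coeff_mk, hf (m - 1) (by omega)]

theorem geomCoeff_of_neg (m : ℤ) (hm : m < 0) : geomCoeff d m = 0 := if_neg (by omega)

-- The symbol is (1 + w)(1 - w^d)/(1 - w). The factors 1 + w and 1 - w are exchanged between the two
-- series, so that 1 - w^d meets 1/(1 - w^d).
open PowerSeries in
theorem mk_symbolCoeff_mul (hd : 0 < d) :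
    (mk fun m : ℕ => symbolCoeff d m) * (mk fun m : ℕ => symbolInvCoeff d m) = 1 := by
  have h1 := mk_add_shift (geomCoeff d) geomCoeff_of_neg
  have h2 := mk_sub_shift (cycloInvCoeff d) (cycloInvCoeff_of_neg hd) 1
  have h3 := mk_sub_shift (geomCoeff d) geomCoeff_of_neg 1
  have h4 := mk_add_shift (cycloInvCoeff d) (cycloInvCoeff_of_neg hd)
  have h5 := mk_sub_shift (fun m => if 0 ≤ m ∧ (d : ℤ) ∣ m then 1 else 0)
    (fun m hm => if_neg (by omega)) d
  have h6 : (mk fun m : ℕ => geomCoeff d m - geomCoeff d (m - (1 : ℕ))) = 1 - X ^ d := by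
    ext m
    rw [coeff_mk, map_sub, coeff_one, coeff_X_pow, geomCoeff, geomCoeff]
    split_ifs <;> omega
  have h7 : (mk fun m : ℕ => (if 0 ≤ (m : ℤ) ∧ (d : ℤ) ∣ m then 1 else 0) -
      (if 0 ≤ (m : ℤ) - d ∧ (d : ℤ) ∣ m - d then 1 else 0)) = (1 : ℤ⟦X⟧) := by
    ext m
    rw [coeff_mk, coeff_one]
    have hiff : (d : ℤ) ∣ m - d ↔ (d : ℤ) ∣ m := by simp
    simp only [hiff]
    by_cases hdm : (d : ℤ) ∣ m
    · have hle : m ≠ 0 → d ≤ m := fun hm =>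
        Nat.le_of_dvd (Nat.pos_of_ne_zero hm) (Int.natCast_dvd_natCast.1 hdm)
      simp only [hdm, and_true]
      split_ifs <;> omega
    · have : m ≠ 0 := by rintro rfl; simp at hdm
      simp [hdm, this]
  simp only [cycloInvCoeff_add hd] at h4
  rw [h6, pow_one] at h3
  rw [h7, ← h4] at h5
  simp only [Nat.cast_one, pow_one] at h2
  change (mk fun m : ℕ => geomCoeff d m + geomCoeff d (m - 1)) *
    (mk fun m : ℕ => cycloInvCoeff d m - cycloInvCoeff d (m - 1)) = 1
  rw [← h1, ← h2]
  linear_combination h5 + (mk fun m : ℕ => cycloInvCoeff d m) * (1 + X) * h3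

theorem symbol_convolution (hd : 0 < d) (m : ℕ) :
    ∑ u ∈ Finset.range (m + 1), symbolCoeff d ((m : ℤ) - u) * symbolInvCoeff d u =
      if m = 0 then 1 else 0 := by
  have h := congrArg (PowerSeries.coeff m) (mk_symbolCoeff_mul hd)
  rw [PowerSeries.coeff_mul, PowerSeries.coeff_one,
    Finset.Nat.sum_antidiagonal_eq_sum_range_succ_mk, ← Finset.sum_range_reflect] at h
  rw [← h]
  refine Finset.sum_congr rfl fun u hu => ?_
  rw [Finset.mem_range] at hu
  simp only [PowerSeries.coeff_mk]
  congr 2 <;> omega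

end Sequences

/-! ### From the symbol to one jump -/

/-- The Hankel determinant of the symbol coefficients in terms of a small step determinant. -/
theorem det_symbolCoeff_hankel {d : ℕ} (hd : 0 < d) (n r : ℕ) (M δ : ℤ) (hn : (n : ℤ) = d * M + δ)
    (hδ : |δ| + r ≤ d) :
    (Matrix.of fun i j : Fin n =>
      symbolCoeff d (((i : ℕ) : ℤ) + ((j : ℕ) : ℤ) + r + 1 - n)).det =
      revSign n * (Matrix.of fun i j : Fin r =>
        stepSeq (signCount d (M - 1)) (signCount d M)
          (δ + (((i : ℕ) : ℤ) - ((j : ℕ) : ℤ)))).det := by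
  set S := Matrix.of fun i j : Fin r => stepSeq (signCount d (M - 1)) (signCount d M)
          (δ + (((i : ℕ) : ℤ) - ((j : ℕ) : ℤ))) with hS
  rw [det_hankel_complement (symbolCoeff d) (symbolInvCoeff d)]
  · have h1 := det_hankel_eq_toeplitz (fun s => symbolInvCoeff d (n - s)) r
    have h2 : (Matrix.of fun i j : Fin r =>
        symbolInvCoeff d (n - (((i : ℕ) : ℤ) - ((j : ℕ) : ℤ)))).det = (-1) ^ (n * r) * S.det := by
      -- After transposition the entry carries the sign (-1)^(n+i-j), which splits into a row factor
      -- `w i` and a column factor `v j`.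
      let v : Fin r → ℤ := fun i => (((i : ℕ) : ℤ).negOnePow : ℤ)
      let w : Fin r → ℤ := fun i => (((n + (i : ℕ) : ℕ) : ℤ).negOnePow : ℤ)
      rw [← Matrix.det_transpose]
      have h3 : (Matrix.of fun i j : Fin r => symbolInvCoeff d
          (n - (((i : ℕ) : ℤ) - ((j : ℕ) : ℤ)))).transpose =
          Matrix.of fun i j : Fin r => w i * (Matrix.of fun i j => v j * S i j) i j := by
        ext i j
        simp only [Matrix.transpose_apply, Matrix.of_apply, hS, v, w]
        rw [show (n : ℤ) - ((j : ℕ) - (i : ℕ)) = d * M + (δ + ((i : ℕ) - (j : ℕ))) by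
            rw [hn]; ring,
          symbolInvCoeff_add hd, ← mul_assoc, ← Units.val_mul, ← Int.negOnePow_add]
        · congr 2
          rw [show (d : ℤ) * M + (δ + ((i : ℕ) - (j : ℕ))) =
            ((n + (i : ℕ) : ℕ) : ℤ) - (j : ℕ) by push_cast; rw [hn]; ring,
            Int.negOnePow_sub, Int.negOnePow_add]
        · rw [abs_lt]
          have hab := abs_le.1 (le_refl |δ|)
          have := i.2
          have := j.2
          constructor <;> omega
      have h4 : ∏ i, w i * v i = (-1) ^ (n * r) := by
        have : ∀ i, w i * v i = (-1) ^ n := by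
          intro i
          simp only [w, v]
          rw [← Units.val_mul, Nat.cast_add, Int.negOnePow_add, mul_assoc, Int.units_mul_self,
            mul_one, Int.negOnePow_def]
          simp
        simp only [this, Finset.prod_const, Finset.card_univ, Fintype.card_fin, pow_mul]
      rw [h3, Matrix.det_mul_column, Matrix.det_mul_row, ← mul_assoc, ← Finset.prod_mul_distrib,
        h4]
    rw [h2] at h1
    have h5 : (Matrix.of fun i j : Fin r =>
        symbolInvCoeff d ((n : ℤ) + r - 1 - ((i : ℕ) : ℤ) - ((j : ℕ) : ℤ))) =
        Matrix.of fun i j : Fin r =>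
          symbolInvCoeff d (n - (((i : ℕ) : ℤ) + ((j : ℕ) : ℤ) + 1 - r)) := by
      ext i j
      simp only [Matrix.of_apply]
      congr 1
      ring
    rw [h5, h1, revSign_add, mul_comm r n]
    have h6 := revSign_mul_self r
    have h7 : ((-1 : ℤ) ^ (n * r)) * (-1) ^ (n * r) = 1 := by
      rw [← mul_pow]; norm_num
    calc _ = ((-1 : ℤ) ^ (n * r) * (-1) ^ (n * r)) * (revSign r * revSign r) *
          (revSign n * S.det) := by ring
      _ = _ := by rw [h6, h7]; ring
  · intro m hm
    rw [symbolCoeff, geomCoeff_of_neg _ hm, geomCoeff_of_neg _ (by omega), add_zero]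
  · intro m hm
    rw [symbolInvCoeff, cycloInvCoeff_of_neg hd _ hm, cycloInvCoeff_of_neg hd _ (by omega),
      sub_zero]
  · rw [symbolCoeff, geomCoeff_of_neg (0 - 1) (by omega), geomCoeff, if_pos (by omega), add_zero]
  · exact symbol_convolution hd

/-! ### Separation of parities by the zigzag order -/

/-- The position of `i` when `0, …, n - 1` are listed in the order
`…, 5, 3, 1, 0, 2, 4, …`. -/
noncomputable def zigzag (n : ℕ) : Fin n ≃ Fin n :=
  Equiv.ofBijective
    (fun i => ⟨if (i : ℕ) % 2 = 0 then n / 2 + i / 2 else n / 2 - (i + 1) / 2, by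
      have := i.2
      split_ifs <;> omega⟩)
    (Finite.injective_iff_bijective.1 fun i j hij => by
      have hi := i.2
      have hj := j.2
      have h := congrArg Fin.val hij
      dsimp only at h
      apply Fin.ext
      split_ifs at h <;> omega)

theorem zigzag_val (n : ℕ) (i : Fin n) : ((zigzag n i : ℕ) : ℤ) =
    if (i : ℕ) % 2 = 0 then ((n / 2 : ℕ) : ℤ) + (((i : ℕ) / 2 : ℕ) : ℤ)
    else ((n / 2 : ℕ) : ℤ) - ((((i : ℕ) + 1) / 2 : ℕ) : ℤ) := by
  have := i.2
  simp only [zigzag, Equiv.ofBijective_apply]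
  split_ifs <;> omega

theorem adjSum_parityWindow_of_parity (k : ℕ) (s : ℤ) (hs : (s - k) % 2 = 0) :
    adjSum (parityWindow k) s = 0 := by
  rw [adjSum_apply, parityWindow, parityWindow, if_neg (by omega), if_neg (by omega), add_zero]

theorem adjSum_parityWindow_eq (k : ℕ) (s m : ℤ) (hs : s = 2 * m - (k + 1) ∨ s = k + 1 - 2 * m) :
    adjSum (parityWindow k) s = symbolCoeff (k + 1) m := by
  have h : ∀ t m : ℤ, (t = 2 * m - k ∨ t = k - 2 * m) →
      parityWindow k t = geomCoeff (k + 1) m := by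
    intro t m ht
    unfold parityWindow geomCoeff
    congr 1
    apply propext
    push_cast
    omega
  rw [adjSum_apply, symbolCoeff]
  rcases hs with hs | hs
  · rw [h (s - 1) (m - 1) (by omega), h (s + 1) m (by omega), add_comm]
  · rw [h (s - 1) m (by omega), h (s + 1) (m - 1) (by omega)]

/-- Here f lives on even indices, so i - j survives for equal parities and i + j + 1 for opposite
ones. Both equal twice the difference of the zigzag positions up to sign, whence a Toeplitz matrix.
-/
theorem det_binomSumHankel_odd (n k r : ℕ) (hk : k + 1 = 2 * r) :
    (binomSumHankel n k).det = revSign n * (Matrix.of fun i j : Fin n =>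
      symbolCoeff (k + 1) (((i : ℕ) : ℤ) + ((j : ℕ) : ℤ) + r + 1 - n)).det := by
  have h1 := det_hankel_eq_toeplitz (fun s => symbolCoeff (k + 1) (s + r)) n
  have h2 : (Matrix.of fun i j : Fin n =>
      symbolCoeff (k + 1) (((i : ℕ) : ℤ) + ((j : ℕ) : ℤ) + r + 1 - n)) =
      Matrix.of fun i j : Fin n =>
        symbolCoeff (k + 1) (((i : ℕ) : ℤ) + ((j : ℕ) : ℤ) + 1 - n + r) := by
    ext i j
    simp only [Matrix.of_apply]
    congr 1
    ring
  rw [h2, h1, ← mul_assoc, revSign_mul_self, one_mul, det_binomSumHankel,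
    ← Matrix.det_submatrix_equiv_self (zigzag n)
      (Matrix.of fun i j : Fin n => symbolCoeff (k + 1) _)]
  congr 1
  ext i j
  simp only [Matrix.of_apply, Matrix.submatrix_apply, zigzag_val]
  rcases Nat.mod_two_eq_zero_or_one i with hi | hi <;>
    rcases Nat.mod_two_eq_zero_or_one j with hj | hj <;>
    simp only [hi, hj, if_true, if_false, one_ne_zero]
  · rw [adjSum_parityWindow_of_parity _ _ (by omega), zero_add]
    exact adjSum_parityWindow_eq _ _ _ (by omega)
  · rw [adjSum_parityWindow_of_parity k (((i : ℕ) : ℤ) - ((j : ℕ) : ℤ)) (by omega), add_zero]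
    exact adjSum_parityWindow_eq _ _ _ (by omega)
  · rw [adjSum_parityWindow_of_parity k (((i : ℕ) : ℤ) - ((j : ℕ) : ℤ)) (by omega), add_zero]
    exact adjSum_parityWindow_eq _ _ _ (by omega)
  · rw [adjSum_parityWindow_of_parity _ _ (by omega), zero_add]
    exact adjSum_parityWindow_eq _ _ _ (by omega)

/-- Now f lives on odd indices and the roles of i - j and i + j + 1 are exchanged, so the sum of the
zigzag positions matters and the matrix is Hankel. The term `n % 2` in r compensates for the rounded
centre `n / 2` of the zigzag. -/
theorem det_binomSumHankel_even (n k r : ℕ) (hk : k % 2 = 0) (hr : r = k / 2 + n % 2) :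
    (binomSumHankel n k).det = (Matrix.of fun i j : Fin n =>
      symbolCoeff (k + 1) (((i : ℕ) : ℤ) + ((j : ℕ) : ℤ) + r + 1 - n)).det := by
  rw [det_binomSumHankel, ← Matrix.det_submatrix_equiv_self (zigzag n)
    (Matrix.of fun i j : Fin n => symbolCoeff (k + 1) _)]
  congr 1
  ext i j
  simp only [Matrix.of_apply, Matrix.submatrix_apply, zigzag_val]
  rcases Nat.mod_two_eq_zero_or_one i with hi | hi <;>
    rcases Nat.mod_two_eq_zero_or_one j with hj | hj <;>
    simp only [hi, hj, if_true, if_false, one_ne_zero]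
  · rw [adjSum_parityWindow_of_parity k (((i : ℕ) : ℤ) - ((j : ℕ) : ℤ)) (by omega), add_zero]
    exact adjSum_parityWindow_eq _ _ _ (by omega)
  · rw [adjSum_parityWindow_of_parity _ _ (by omega), zero_add]
    exact adjSum_parityWindow_eq _ _ _ (by omega)
  · rw [adjSum_parityWindow_of_parity _ _ (by omega), zero_add]
    exact adjSum_parityWindow_eq _ _ _ (by omega)
  · rw [adjSum_parityWindow_of_parity k (((i : ℕ) : ℤ) - ((j : ℕ) : ℤ)) (by omega), add_zero]
    exact adjSum_parityWindow_eq _ _ _ (by omega)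

/-! ### Evaluation by residue of n modulo d -/

/-- The value, up to the factor `revSign n`, of the Hankel determinant of `symbolCoeff d` of size
`n = d q + s`. -/
def symbolDetValue (d r q s : ℕ) : ℤ :=
  if s = 0 then (if Even r then 1 else signCount d ((q : ℤ) - 1) + signCount d q)
  else if s = 1 then (signCount d q - signCount d ((q : ℤ) - 1)) ^ (r - 1) * (2 * signCount d q)
  else if s + 1 = d then
    (signCount d q - signCount d ((q : ℤ) + 1)) ^ (r - 1) * (2 * signCount d q)
  else 0

theorem det_symbolCoeff_hankel_eq (d n r q s : ℕ) (hd : 0 < d) (hr : d = 2 * r ∨ d = 2 * r + 1 ∨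
    d + 1 = 2 * r) (hn : n = d * q + s) (hs : s < d) :
    (Matrix.of fun i j : Fin n =>
      symbolCoeff d (((i : ℕ) : ℤ) + ((j : ℕ) : ℤ) + r + 1 - n)).det =
      revSign n * symbolDetValue d r q s := by
  have hnz : (n : ℤ) = d * q + s := by exact_mod_cast hn
  unfold symbolDetValue
  split_ifs with h0 hr2 h1 h2
  · rw [det_symbolCoeff_hankel hd n r q 0 (by rw [hnz, h0]; rfl) (by simp; omega),
      det_step_zero _ r, if_pos hr2]
    rw [signCount_sub _ _ (by positivity), ← Units.val_mul, Int.units_mul_self, Units.val_one]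
  · rw [det_symbolCoeff_hankel hd n r q 0 (by rw [hnz, h0]; rfl) (by simp; omega),
      det_step_zero _ r, if_neg hr2]
    rw [signCount_sub _ _ (by positivity), ← Units.val_mul, Int.units_mul_self, Units.val_one]
  · obtain ⟨r, rfl⟩ : ∃ r', r = r' + 1 := ⟨r - 1, by omega⟩
    rw [det_symbolCoeff_hankel hd n (r + 1) q 1 (by rw [hnz, h1]; rfl) (by simp; omega),
      det_step_add_one, Nat.add_sub_cancel]
  · obtain ⟨r, rfl⟩ : ∃ r', r = r' + 1 := ⟨r - 1, by omega⟩
    rw [det_symbolCoeff_hankel hd n (r + 1) (q + 1) (-1)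
      (by rw [hnz, ← h2]; push_cast; ring) (by simp; omega),
      det_step_sub_one, Nat.add_sub_cancel, add_sub_cancel_right]
  -- Now 2 ≤ s ≤ d - 2, so d ≥ 4 and r ≥ 2. Measured from the nearest multiple of d, the offset is
  -- at most d/2, so the minor stays inside the window of a single jump.
  · rcases le_or_gt (2 * s) d with h3 | h3
    · rw [det_symbolCoeff_hankel hd n r q s hnz (by rw [abs_of_nonneg (by omega)]; omega),
        det_step_of_two_le _ _ _ _ (by omega) (by omega)]
    · rw [det_symbolCoeff_hankel hd n r (q + 1) (s - d) (by rw [hnz]; ring)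
        (by rw [abs_of_nonpos (by omega)]; omega),
        det_step_of_le_neg_two _ _ _ _ (by omega) (by omega)]

theorem signCount_even {d : ℕ} (hd : Even d) (q : ℤ) (hq : -1 ≤ q) : signCount d q = q + 1 := by
  unfold signCount
  split_ifs <;> omega

theorem signCount_odd {d : ℕ} (hd : Odd d) (q : ℤ) (hq : -1 ≤ q) :
    signCount d q = if q % 2 = 0 then 1 else 0 := by
  unfold signCount
  simp only [Nat.not_even_iff_odd.2 hd, if_false, Int.even_iff]
  split_ifs <;> omega

theorem det_binomSumHankel_eq (n k : ℕ) : (binomSumHankel n k).det = hankelValue n k := by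
  unfold hankelValue
  have hn : n = (k + 1) * (n / (k + 1)) + n % (k + 1) := (Nat.div_add_mod n (k + 1)).symm
  have hs : n % (k + 1) < k + 1 := Nat.mod_lt _ (by omega)
  generalize n / (k + 1) = q at hn
  generalize n % (k + 1) = s at hn hs
  have c0 : n = (k + 1) * q ↔ s = 0 := by omega
  have c1 : n = (k + 1) * q + 1 ↔ s = 1 := by omega
  have c2 : n = (k + 1) * q + k ↔ s = k := by omega
  simp only [hankelCases, c0, c1, c2]
  rcases Nat.even_or_odd k with hk | hk
  -- For odd d the levels are 1 or 0 according to the parity of q, and `revSign n` supplies the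
  -- sign.
  · have hko : ¬ Odd k := Nat.not_odd_iff_even.2 hk
    have hk2 := Nat.even_iff.1 hk
    rw [det_binomSumHankel_even n k _ hk2 rfl,
      det_symbolCoeff_hankel_eq (k + 1) n _ q s (by omega) (by omega) hn hs]
    have hm1 : ¬ (s = 0 ∧ k % 4 = 1) := by omega
    have hm3 : ¬ (s = 0 ∧ k % 4 = 3) := by omega
    simp only [symbolDetValue, signCount_odd hk.add_one _ (show -1 ≤ (q : ℤ) - 1 by omega),
      signCount_odd hk.add_one _ (show -1 ≤ (q : ℤ) by omega),
      signCount_odd hk.add_one _ (show -1 ≤ (q : ℤ) + 1 by omega), hk, hko, hm1, hm3, true_and,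
      and_false, if_false, Nat.add_right_cancel_iff]
    obtain ⟨t, rfl⟩ := hk
    rcases Nat.even_or_odd' q with ⟨u, rfl | rfl⟩
    · have hq1 : Even (2 * u) := even_two_mul u
      have hq2 : ¬ Odd (2 * u) := Nat.not_odd_iff_even.2 hq1
      have hX : n = 2 * ((2 * t + 1) * u) + s := by rw [hn]; ring
      have hpow : (-1 : ℤ) ^ ((2 * t + 1) * u) = (-1) ^ u :=
        neg_one_pow_congr (by simp [parity_simps])
      rw [if_neg (show ¬ (((2 * u : ℕ) : ℤ) - 1) % 2 = 0 by omega),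
        if_pos (show ((2 * u : ℕ) : ℤ) % 2 = 0 by omega),
        if_neg (show ¬ (((2 * u : ℕ) : ℤ) + 1) % 2 = 0 by omega)]
      simp only [hq1, hq2, and_true, and_false, if_false, zero_add, ite_self, sub_zero, one_pow,
        one_mul, mul_one, mul_ite, mul_zero]
      split_ifs with h0 h1 h2
      · rw [hX, h0, add_zero, (revSign_even_odd _).1, hpow]
        congr 1
        omega
      · rw [hX, h1, (revSign_even_odd _).2, hpow, mul_comm]
        congr 2
        omega
      · rw [hX, h2, ← two_mul, ← mul_add, (revSign_even_odd _).1, pow_add, hpow, ← pow_add,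
          mul_comm]
        congr 2
        omega
      · rfl
    · have hq1 : Odd (2 * u + 1) := odd_two_mul_add_one u
      have hq2 : ¬ Even (2 * u + 1) := Nat.not_even_iff_odd.2 hq1
      rw [if_pos (show (((2 * u + 1 : ℕ) : ℤ) - 1) % 2 = 0 by omega),
        if_neg (show ¬ ((2 * u + 1 : ℕ) : ℤ) % 2 = 0 by omega)]
      simp only [hq1, hq2, and_true, and_false, if_false, add_zero, ite_self, mul_one, mul_ite,
        mul_zero]
      split_ifs with h0
      · have hX : n = 2 * ((2 * t + 1) * u + t) + 1 := by rw [hn, h0]; ring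
        have hdiv : (t + t + (2 * u + 1) - 1) / 2 = t + u := by omega
        rw [hX, (revSign_even_odd _).2, hdiv]
        refine neg_one_pow_congr ?_
        simp only [Nat.even_add, Nat.even_mul, parity_simps]
        tauto
      · rfl
  -- For even d the two reversal signs cancel and the level at q is q + 1.
  · have hke : ¬ Even k := Nat.not_even_iff_odd.2 hk
    have hk2 := Nat.odd_iff.1 hk
    obtain ⟨r, hr⟩ : ∃ r, k + 1 = 2 * r := ⟨(k + 1) / 2, by omega⟩
    rw [det_binomSumHankel_odd n k r hr,
      det_symbolCoeff_hankel_eq (k + 1) n _ q s (by omega) (by omega) hn hs, ← mul_assoc,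
      revSign_mul_self, one_mul]
    simp only [symbolDetValue, signCount_even hk.add_one _ (show -1 ≤ (q : ℤ) - 1 by omega),
      signCount_even hk.add_one _ (show -1 ≤ (q : ℤ) by omega),
      signCount_even hk.add_one _ (show -1 ≤ (q : ℤ) + 1 by omega), hk, hke, and_true,
      and_false, false_and, if_false, Nat.add_right_cancel_iff]
    have e1 : (q : ℤ) + 1 - ((q : ℤ) - 1 + 1) = 1 := by ring
    have e2 : (q : ℤ) + 1 - ((q : ℤ) + 1 + 1) = -1 := by ring
    have e3 : (k - 1) / 2 = r - 1 := by omega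
    rw [e1, e2, e3, one_pow]
    simp only [Nat.even_iff]
    split_ifs <;> first | omega | ring

theorem det_central (n : ℕ) :
    (Matrix.of fun i j : Fin n =>
      (((i : ℕ) + (j : ℕ) + 2).choose (((i : ℕ) + (j : ℕ) + 3) / 2) : ℤ)).det = (n : ℤ) + 1 := by
  -- For k = 1 the two summands combine by Pascal's rule.
  have h : (Matrix.of fun i j : Fin n =>
      (((i : ℕ) + (j : ℕ) + 2).choose (((i : ℕ) + (j : ℕ) + 3) / 2) : ℤ)) =
      binomSumHankel n 1 := by
    ext i j
    simp only [binomSumHankel, Matrix.of_apply, Finset.sum_range_succ, Finset.sum_range_zero,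
      zero_add]
    generalize hm : (i : ℕ) + (j : ℕ) = m
    have e0 : (((i : ℕ) : ℤ) + ((j : ℕ) : ℤ) + 2 - ((1 : ℕ) : ℤ)) / 2 + ((0 : ℕ) : ℤ) =
      (((m + 1) / 2 : ℕ) : ℤ) := by omega
    have e1 : (((i : ℕ) : ℤ) + ((j : ℕ) : ℤ) + 2 - ((1 : ℕ) : ℤ)) / 2 + ((1 : ℕ) : ℤ) =
      (((m + 1) / 2 + 1 : ℕ) : ℤ) := by omega
    rw [e0, e1, intBinom, intBinom, if_pos (by positivity), if_pos (by positivity),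
      Int.toNat_natCast, Int.toNat_natCast, show (m + 3) / 2 = (m + 1) / 2 + 1 by omega,
      Nat.choose_succ_succ]
    push_cast
    rfl
  rw [h, det_binomSumHankel_eq, hankelValue, hankelCases]
  rcases Nat.even_or_odd' n with ⟨q, rfl | rfl⟩
  · rw [show 2 * q / (1 + 1) = q by omega, if_pos (by omega)]
    push_cast
    rfl
  · rw [show (2 * q + 1) / (1 + 1) = q by omega, if_neg (by omega), if_neg (by omega),
      if_neg (by omega), if_neg (by omega), if_pos ⟨rfl, odd_one⟩]
    push_cast
    ring

theorem corollary14 :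
    (∀ n k : ℕ, 0 < n → (binomSumHankel n k).det = hankelValue n k) ∧
    (∀ n : ℕ, 0 < n →
      (Matrix.of fun i j : Fin n =>
        (((i : ℕ) + (j : ℕ) + 2).choose (((i : ℕ) + (j : ℕ) + 3) / 2) : ℤ)).det = (n : ℤ) + 1) ∧
    (∀ n : ℕ, 0 < n →
      (Matrix.of fun i j : Fin n =>
        (((i : ℕ) + (j : ℕ) + 2).choose (((i : ℕ) + (j : ℕ) + 2) / 2) : ℤ)).det = (n : ℤ) + 1) := by
  refine ⟨fun n k _ => det_binomSumHankel_eq n k, fun n _ => det_central n, fun n _ => ?_⟩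
  rw [← det_central]
  congr 1
  ext i j
  simp only [Matrix.of_apply]
  congr 1
  exact Nat.choose_symm_of_eq_add (by omega)
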